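/- Let $\Sigma$ be a closed (compact, boundaryless, smooth) connected orientable surface. Then for every $\varepsilon>0$ there exist a magnetic Lagrangian $L_\varepsilon:T\Sigma\to\mathbb R$ with $c_u(L_\varepsilon)\in[\tfrac12-\varepsilon,\tfrac12]$ and points $q_0\neq q_1$ in $\Sigma$ such that, for every real $k<\tfrac12-\varepsilon$, the energy level $E^{-1}(k)$ carries no Euler--Lagrange orbit of $L_\varepsilon$ joining $q_0$ to $q_1$. Here a magnetic Lagrangian is a function $L(q,v)=\tfrac12\|v\|_q^2+\theta_q(v)$, where $\|\cdot\|$ is the norm of a smooth Riemannian metric on $\Sigma$ and $\theta$ is a smooth $1$-form on $\Sigma$; an Euler--Lagrange orbit joining $q_0$ to $q_1$ is a curve $\gamma:[0,T]\to\Sigma$, $T>0$, with $\gamma(0)=q_0$, $\gamma(T)=q_1$, satisfying in local coordinates $\frac{d}{dt}\frac{\partial L}{\partial v}(\gamma,\dot\gamma)=\frac{\partial L}{\partial q}(\gamma,\dot\gamma)$, and it lies on $E^{-1}(k)$ if $E(\gamma(t),\dot\gamma(t))=k$ for all $t$, where $E(q,v)=\frac{\partial L}{\partial v}(q,v)\cdot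 v-L(q,v)$; and the Mañé critical value of the universal cover is $$c_u(L)=\inf\Big\{k\in\mathbb R\ \Big|\ \int_0^T\big[L(\gamma(t),\dot\gamma(t))+k\big]\,dt\ge 0\ \text{ for all } T>0 \text{ and all contractible closed } H^1\text{-loops } \gamma:[0,T]\to\Sigma\Big\}.$$ -/

import Mathlib

open Set MeasureTheory Bundle
open scoped Manifold ContDiff

noncomputable section

/-! Manifolds are boundaryless smooth manifolds modelled on a normed space `E`; a smooth chart is
an element of the maximal smooth atlas. -/

/-- Orientability: there is a family of smooth charts covering `M` all of whose transition maps
have positive Jacobian determinant. -/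
def IsOrientableManifold (E : Type*) [NormedAddCommGroup E] [NormedSpace ℝ E]
    (M : Type*) [TopologicalSpace M] [ChartedSpace E M] : Prop :=
  ∃ A : Set (OpenPartialHomeomorph M E),
    A ⊆ IsManifold.maximalAtlas 𝓘(ℝ, E) ∞ M ∧
    (∀ q : M, ∃ e ∈ A, q ∈ e.source) ∧
    ∀ e ∈ A, ∀ e' ∈ A, ∀ x ∈ (e.symm.trans e').source,
      0 < (fderiv ℝ (e.symm.trans e') x).det

section Lagrangian

variable {E : Type*} [NormedAddCommGroup E] [NormedSpace ℝ E]
variable {M : Type*} [TopologicalSpace M] [ChartedSpace E M]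

/-- A smooth 1-form on `M`, as a smooth section of the cotangent bundle. -/
def IsSmoothOneForm [IsManifold 𝓘(ℝ, E) ∞ M]
    (θ : ∀ q : M, TangentSpace 𝓘(ℝ, E) q →L[ℝ] ℝ) : Prop :=
  ContMDiff 𝓘(ℝ, E) (𝓘(ℝ, E).prod 𝓘(ℝ, E →L[ℝ] ℝ)) ∞
    (fun q : M ↦ TotalSpace.mk' (E →L[ℝ] ℝ)
      (E := fun q : M ↦ TangentSpace 𝓘(ℝ, E) q →L[ℝ] ℝ) q (θ q))

/-- `L(q, v) = ½ ‖v‖_q² + θ_q(v)`, with the norm of a smooth Riemannian metric `g` and a smooth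
1-form `θ`. -/
def IsMagneticLagrangian [IsManifold 𝓘(ℝ, E) ∞ M] (L : TangentBundle 𝓘(ℝ, E) M → ℝ) : Prop :=
  ∃ (g : ContMDiffRiemannianMetric 𝓘(ℝ, E) ∞ E (fun q : M ↦ TangentSpace 𝓘(ℝ, E) q))
    (θ : ∀ q : M, TangentSpace 𝓘(ℝ, E) q →L[ℝ] ℝ),
    IsSmoothOneForm θ ∧
    ∀ (q : M) (v : TangentSpace 𝓘(ℝ, E) q), L ⟨q, v⟩ = 1 / 2 * g.inner q v v + θ q v

/-- The energy `E(q, v) = ∂L/∂v (q, v) · v - L(q, v)`, where `∂L/∂v` is the derivative of the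
restriction of `L` to the fibre. -/
def lagrangianEnergy (L : TangentBundle 𝓘(ℝ, E) M → ℝ) (p : TangentBundle 𝓘(ℝ, E) M) : ℝ :=
  fderiv ℝ (fun w : TangentSpace 𝓘(ℝ, E) p.1 ↦ L ⟨p.1, w⟩) p.2 p.2 - L p

/-- The expression of `L` in a chart `e`: the pull-back of `L` by `(x, v) ↦ (e⁻¹ x, D(e⁻¹)ₓ v)`. -/
def localLagrangian (L : TangentBundle 𝓘(ℝ, E) M → ℝ) (e : OpenPartialHomeomorph M E)
    (x v : E) : ℝ :=
  L ⟨e.symm x, mfderiv 𝓘(ℝ, E) 𝓘(ℝ, E) e.symm x v⟩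

/-- `γ` is a (twice continuously differentiable) solution of the Euler-Lagrange equation
`d/dt ∂L/∂v (γ, γ') = ∂L/∂q (γ, γ')` on the interval `J`, the equation being required in all
smooth charts. -/
def IsEulerLagrangeOn (L : TangentBundle 𝓘(ℝ, E) M → ℝ) (γ : ℝ → M) (J : Set ℝ) : Prop :=
  ContMDiffOn 𝓘(ℝ, ℝ) 𝓘(ℝ, E) 2 γ J ∧
  ∀ e ∈ IsManifold.maximalAtlas 𝓘(ℝ, E) ∞ M, ∀ t ∈ J, γ t ∈ e.source →
    HasDerivWithinAt
      (fun s ↦ fderiv ℝ (fun v ↦ localLagrangian L e (e (γ s)) v) (derivWithin (e ∘ γ) J s))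
      (fderiv ℝ (fun x ↦ localLagrangian L e x (derivWithin (e ∘ γ) J t)) (e (γ t))) J t

/-- The energy level `{E = k}` carries an Euler-Lagrange orbit joining `q₀` to `q₁`: there is a
solution `γ : [0, T] → M`, `T > 0`, from `q₀` to `q₁` whose velocity `(γ, γ')` stays in
the level. -/
def JoinedByOrbitOfEnergy (L : TangentBundle 𝓘(ℝ, E) M → ℝ) (k : ℝ) (q₀ q₁ : M) : Prop :=
  ∃ (T : ℝ) (γ : ℝ → M), 0 < T ∧ γ 0 = q₀ ∧ γ T = q₁ ∧
    IsEulerLagrangeOn L γ (Icc 0 T) ∧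
    ∀ t ∈ Icc 0 T,
      lagrangianEnergy L ⟨γ t, mfderivWithin 𝓘(ℝ, ℝ) 𝓘(ℝ, E) γ (Icc 0 T) t (1 : ℝ)⟩ = k

/-- `x : [0, 1] → M` is of Sobolev class `H¹`: it is continuous and, in charts, absolutely
continuous with square-integrable derivative. -/
def IsH1Curve (E : Type*) [NormedAddCommGroup E] [NormedSpace ℝ E] {M : Type*}
    [TopologicalSpace M] [ChartedSpace E M] (x : ℝ → M) : Prop :=
  ContinuousOn x (Icc 0 1) ∧
  ∀ e ∈ IsManifold.maximalAtlas 𝓘(ℝ, E) ∞ M, ∀ a b : ℝ, 0 ≤ a → a ≤ b → b ≤ 1 →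
    MapsTo x (Icc a b) e.source →
      AbsolutelyContinuousOnInterval (e ∘ x) a b ∧
      MemLp (deriv (e ∘ x)) 2 (volume.restrict (Ioo a b))

/-- The free-time action `A_k(x, T) = T ∫₀¹ [L(x(s), x'(s)/T) + k] ds`, that is
`∫₀ᵀ [L(γ, γ') + k] dt` for `γ(t) = x(t/T)`. -/
def freeTimeAction (L : TangentBundle 𝓘(ℝ, E) M → ℝ) (k : ℝ) (x : ℝ → M) (T : ℝ) : ℝ :=
  T * ∫ s in (0 : ℝ)..1,
    (L ⟨x s, T⁻¹ • mfderiv 𝓘(ℝ, ℝ) 𝓘(ℝ, E) x s (1 : ℝ)⟩ + k)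

/-- The Mañé critical value of the universal cover: the infimum of the `k : ℝ` such that
`A_k(γ) ≥ 0` for every contractible closed loop `γ = (x, T)`; the infimum is taken in the extended
reals. -/
def maneCriticalValueUniversal (L : TangentBundle 𝓘(ℝ, E) M → ℝ) : EReal :=
  sInf ((fun k : ℝ ↦ (k : EReal)) ''
    {k : ℝ | ∀ (q : M) (x : Path q q) (T : ℝ), 0 < T → IsH1Curve E x.extend →
      x.Homotopic (Path.refl q) → 0 ≤ freeTimeAction L k x.extend T})

end Lagrangian

end

/-! Everything happens in one coordinate disc. Over a closed disc of radius R about the centre c of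
a chart at q₀, the metric is made Euclidean, and θ is the form ψ(x) R⁻¹ ⟨A(x - c), ·⟩, where A is
the quarter turn and ψ a bump function equal to 1 for |x - c| ≤ r = sR, with 0 < s < 1. Put b = R⁻¹.

Since |θ| ≤ 1, L + 1/2 ≥ (|v| - 1)²/2 ≥ 0, so the critical value is at most 1/2. On the inner disc
the magnetic field is uniform, of strength 2b. The circle of radius r, run against θ at speed br,
has L = -(br)²/2 throughout; it bounds a disc, so the critical value is at least (br)²/2 = s²/2
(`le_maneCriticalValueUniversal`).

Orbits in a uniform field preserve v + 2bA(x - c). Starting at c with speed √(2k), an orbit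
therefore satisfies |x - c| ≤ √(2k)/b, which is less than r when k < s²/2. So it never reaches a
point q₁ of the circle of radius r (`not_joinedByOrbitOfEnergy`). Choosing s²/2 = 1/2 - δ with δ ≤ ε
concludes. -/

open scoped Topology InnerProductSpace

/-! ### Pulling back 1-forms through a chart -/

section Charts

variable {E : Type*} [NormedAddCommGroup E] [NormedSpace ℝ E]
variable {M : Type*} [TopologicalSpace M] [ChartedSpace E M] [IsManifold 𝓘(ℝ, E) ∞ M]

/-- The differential at `q` of the preferred chart at `q₀`, extended by zero outside the domain of
the chart. -/
noncomputable def chartDifferential (q₀ q : M) : TangentSpace 𝓘(ℝ, E) q →L[ℝ] E :=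
  (trivializationAt E (TangentSpace 𝓘(ℝ, E)) q₀).continuousLinearMapAt ℝ q

lemma chartDifferential_eq_zero {q₀ q : M} (hq : q ∉ (chartAt E q₀).source) :
    chartDifferential (E := E) q₀ q = 0 := by
  ext v
  simp [chartDifferential, Trivialization.linearMapAt_def_of_notMem, hq]

lemma chartDifferential_eq_mfderiv {q₀ q : M} (hq : q ∈ (chartAt E q₀).source) :
    chartDifferential (E := E) q₀ q = mfderiv 𝓘(ℝ, E) 𝓘(ℝ, E) (chartAt E q₀) q := by
  rw [chartDifferential, TangentBundle.continuousLinearMapAt_trivializationAt hq]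
  simp [extChartAt]
  rfl

lemma chartDifferential_injective {q₀ q : M} (hq : q ∈ (chartAt E q₀).source) :
    Function.Injective (chartDifferential (E := E) q₀ q) := by
  have hq' : q ∈ (trivializationAt E (TangentSpace 𝓘(ℝ, E)) q₀).baseSet := by simpa using hq
  intro v w h
  have := congrArg ((trivializationAt E (TangentSpace 𝓘(ℝ, E)) q₀).symmL ℝ q) h
  simpa only [chartDifferential, Trivialization.symmL_continuousLinearMapAt _ hq'] using this

lemma chartDifferential_symm {q₀ q : M} (hq : q ∈ (chartAt E q₀).source) (v : E) :
    chartDifferential q₀ q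
      ((trivializationAt E (TangentSpace 𝓘(ℝ, E)) q₀).symmL ℝ q v) = v := by
  have hq' : q ∈ (trivializationAt E (TangentSpace 𝓘(ℝ, E)) q₀).baseSet := by simpa using hq
  exact Trivialization.continuousLinearMapAt_symmL _ hq' v

/-- The pull-back of a 1-form by a chart is smooth on the domain of the chart. -/
lemma contMDiffOn_oneForm_pullback (q₀ : M) (a : E → E →L[ℝ] ℝ) (ha : ContDiff ℝ ∞ a) :
    ContMDiffOn 𝓘(ℝ, E) (𝓘(ℝ, E).prod 𝓘(ℝ, E →L[ℝ] ℝ)) ∞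
      (fun q : M ↦ TotalSpace.mk' (E →L[ℝ] ℝ)
        (E := fun q : M ↦ TangentSpace 𝓘(ℝ, E) q →L[ℝ] ℝ) q
        ((a (chartAt E q₀ q)).comp (chartDifferential q₀ q)))
      (chartAt E q₀).source := by
  have := (trivializationAt (E →L[ℝ] ℝ)
    (fun q : M ↦ TangentSpace 𝓘(ℝ, E) q →L[ℝ] ℝ) q₀).contMDiffOn_section_iff
      (IB := 𝓘(ℝ, E)) (n := ∞)
      (s := fun q : M ↦ (a (chartAt E q₀ q)).comp (chartDifferential q₀ q))
      (a := (chartAt E q₀).source) (chartAt E q₀).open_source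
      (by intro q hq; rw [hom_trivializationAt_baseSet]; simpa using hq)
  refine this.2 ?_
  have h : ContMDiffOn 𝓘(ℝ, E) 𝓘(ℝ, E →L[ℝ] ℝ) ∞ (fun q : M ↦ a (chartAt E q₀ q))
      (chartAt E q₀).source := ha.contMDiff.comp_contMDiffOn contMDiffOn_chart
  refine h.congr fun q hq ↦ ?_
  rw [hom_trivializationAt_apply]
  ext v
  simp only [ContinuousLinearMap.inCoordinates, ContinuousLinearMap.comp_apply,
    chartDifferential_symm hq v]
  simp

/-- The image of K in M is compact, hence closed since M is Hausdorff. Away from it the form is the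
zero section, and it is smooth on the chart domain; these two open sets cover M. -/
lemma isSmoothOneForm_pullback [T2Space M] (q₀ : M) (a : E → E →L[ℝ] ℝ) (ha : ContDiff ℝ ∞ a)
    {K : Set E} (hK : IsCompact K) (hKt : K ⊆ (chartAt E q₀).target) (haK : ∀ x ∉ K, a x = 0) :
    IsSmoothOneForm (fun q : M ↦ (a (chartAt E q₀ q)).comp (chartDifferential q₀ q)) := by
  have hK' : IsClosed ((chartAt E q₀).symm '' K) :=
    (hK.image_of_continuousOn ((chartAt E q₀).continuousOn_symm.mono hKt)).isClosed
  intro q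
  by_cases hq : q ∈ (chartAt E q₀).source
  · exact (contMDiffOn_oneForm_pullback q₀ a ha).contMDiffAt
      ((chartAt E q₀).open_source.mem_nhds hq)
  · have hq' : q ∈ ((chartAt E q₀).symm '' K)ᶜ := by
      rintro ⟨x, hx, rfl⟩
      exact hq ((chartAt E q₀).map_target (hKt hx))
    have h0 := (contMDiff_zeroSection (𝕜 := ℝ) (IB := 𝓘(ℝ, E)) (n := ∞) (F := E →L[ℝ] ℝ)
      (fun q : M ↦ TangentSpace 𝓘(ℝ, E) q →L[ℝ] ℝ)) q
    refine h0.congr_of_eventuallyEq ?_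
    filter_upwards [hK'.isOpen_compl.mem_nhds hq'] with p hp
    have : (a (chartAt E q₀ p)).comp (chartDifferential (E := E) q₀ p) = 0 := by
      by_cases hps : p ∈ (chartAt E q₀).source
      · rw [haK, ContinuousLinearMap.zero_comp]
        intro h
        exact hp ⟨_, h, (chartAt E q₀).left_inv hps⟩
      · rw [chartDifferential_eq_zero hps, ContinuousLinearMap.comp_zero]
    simp only [zeroSection, TotalSpace.mk']
    rw [this]

end Charts

/-! ### Riemannian metrics that are Euclidean in a chart -/

section Metric

variable {E : Type*} [NormedAddCommGroup E] [InnerProductSpace ℝ E]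
variable {M : Type*} [TopologicalSpace M] [ChartedSpace E M] [IsManifold 𝓘(ℝ, E) ∞ M]

/-- The pull-back of the Euclidean inner product by the preferred chart at `q₀`. -/
noncomputable def chartInner (q₀ q : M) :
    TangentSpace 𝓘(ℝ, E) q →L[ℝ] TangentSpace 𝓘(ℝ, E) q →L[ℝ] ℝ :=
  ((ContinuousLinearMap.precomp ℝ (chartDifferential (E := E) q₀ q)).comp (innerSL ℝ (E := E))).comp
    (chartDifferential (E := E) q₀ q)

lemma chartInner_apply (q₀ q : M) (v w : TangentSpace 𝓘(ℝ, E) q) :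
    chartInner q₀ q v w = ⟪chartDifferential q₀ q v, chartDifferential q₀ q w⟫_ℝ := by
  rfl

-- Read in the trivialization at q₀, this section is the constant Euclidean inner product.
set_option synthInstance.maxHeartbeats 400000 in
set_option maxHeartbeats 1000000 in
lemma contMDiffOn_chartInner (q₀ : M) :
    ContMDiffOn 𝓘(ℝ, E) (𝓘(ℝ, E).prod 𝓘(ℝ, E →L[ℝ] E →L[ℝ] ℝ)) ∞
      (fun q : M ↦ TotalSpace.mk' (E →L[ℝ] E →L[ℝ] ℝ)
        (E := fun q : M ↦ TangentSpace 𝓘(ℝ, E) q →L[ℝ] TangentSpace 𝓘(ℝ, E) q →L[ℝ] ℝ) q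
        (chartInner q₀ q))
      (chartAt E q₀).source := by
  have := (trivializationAt (E →L[ℝ] E →L[ℝ] ℝ)
    (fun q : M ↦ TangentSpace 𝓘(ℝ, E) q →L[ℝ] TangentSpace 𝓘(ℝ, E) q →L[ℝ] ℝ)
      q₀).contMDiffOn_section_iff (F := E →L[ℝ] E →L[ℝ] ℝ)
      (E := fun q : M ↦ TangentSpace 𝓘(ℝ, E) q →L[ℝ] TangentSpace 𝓘(ℝ, E) q →L[ℝ] ℝ)
      (IB := 𝓘(ℝ, E)) (n := ∞)
      (s := fun q : M ↦ chartInner q₀ q)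
      (a := (chartAt E q₀).source) (chartAt E q₀).open_source
      (by intro q hq; rw [hom_trivializationAt_baseSet, hom_trivializationAt_baseSet]
          simpa using hq)
  refine this.2 ?_
  obtain ⟨c, hc⟩ : ∃ c : E →L[ℝ] E →L[ℝ] ℝ, ∀ v w, c v w = ⟪v, w⟫_ℝ :=
    ⟨innerSL ℝ, fun _ _ ↦ rfl⟩
  refine (contMDiffOn_const (c := c)).congr fun q hq ↦ ?_
  rw [hom_trivializationAt_apply]
  ext v w
  simp only [ContinuousLinearMap.inCoordinates, ContinuousLinearMap.comp_apply]
  rw [Trivialization.continuousLinearMapAt_apply, Trivialization.linearMapAt_apply, if_pos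
    (by rw [hom_trivializationAt_baseSet]; simpa using hq), hom_trivializationAt_apply]
  simp only [ContinuousLinearMap.inCoordinates, ContinuousLinearMap.comp_apply, chartInner_apply,
    chartDifferential_symm hq v, chartDifferential_symm hq w, hc]
  simp

/-- By homogeneity, B(v, v) is at least ‖v‖² times its minimum on the compact unit sphere. -/
lemma isVonNBounded_of_pos [FiniteDimensional ℝ E] (B : E →L[ℝ] E →L[ℝ] ℝ)
    (hB : ∀ v, v ≠ 0 → 0 < B v v) : Bornology.IsVonNBounded ℝ {v : E | B v v < 1} := by
  have hc : Continuous fun v : E ↦ B v v := by fun_prop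
  rw [NormedSpace.isVonNBounded_iff]
  rcases subsingleton_or_nontrivial E with h | h
  · exact (Set.toFinite _).isBounded
  obtain ⟨u, hu, hmin⟩ := (isCompact_sphere (0 : E) 1).exists_isMinOn
    (NormedSpace.sphere_nonempty.2 zero_le_one) hc.continuousOn
  have hu0 : 0 < B u u := hB u (by rintro rfl; simp at hu)
  refine (Metric.isBounded_iff_subset_closedBall 0).2 ⟨√(1 / B u u), fun v hv ↦ ?_⟩
  rw [mem_closedBall_zero_iff]
  refine Real.le_sqrt_of_sq_le ?_
  rcases eq_or_ne v 0 with rfl | hv0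
  · simp [hu0.le]
  have hn : 0 < ‖v‖ := norm_pos_iff.2 hv0
  have h1 : B u u ≤ B (‖v‖⁻¹ • v) (‖v‖⁻¹ • v) :=
    hmin (by simp [norm_smul, hn.ne'])
  simp only [map_smul, smul_apply, smul_eq_mul] at h1
  have hv' : B v v < 1 := hv
  rw [le_div_iff₀ hu0]
  calc ‖v‖ ^ 2 * B u u ≤ ‖v‖ ^ 2 * (‖v‖⁻¹ * (‖v‖⁻¹ * B v v)) := by gcongr
    _ = B v v := by field_simp
    _ ≤ 1 := hv'.le

set_option synthInstance.maxHeartbeats 400000 in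
set_option maxHeartbeats 1000000 in
/-- A smooth Riemannian metric which is Euclidean in a given chart over a given compact set. -/
theorem exists_riemannianMetric_eq_chartInner [FiniteDimensional ℝ E] [T2Space M]
    [SigmaCompactSpace M] (q₀ : M) {K : Set M} (hK : IsClosed K) (hKs : K ⊆ (chartAt E q₀).source) :
    ∃ g : ContMDiffRiemannianMetric 𝓘(ℝ, E) ∞ E (fun q : M ↦ TangentSpace 𝓘(ℝ, E) q),
      ∀ q ∈ K, ∀ v w, g.inner q v w = ⟪chartDifferential q₀ q v, chartDifferential q₀ q w⟫_ℝ := by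
  have hsymm (q₁ q : M) (v w) : chartInner (E := E) q₁ q v w = chartInner q₁ q w v := by
    simp only [chartInner_apply]
    exact real_inner_comm _ _
  have hpos (q₁ q : M) (hq : q ∈ (chartAt E q₁).source) (v) (hv : v ≠ 0) :
      0 < chartInner (E := E) q₁ q v v := by
    rw [chartInner_apply]
    exact real_inner_self_pos.2 fun h ↦ hv (chartDifferential_injective hq (by rw [h, map_zero]))
  -- Inner products that must agree with the chart metric over K form a convex set, so local
  -- solutions glue by a partition of unity without disturbing the metric over K.
  let t (q : M) : Set (TangentSpace 𝓘(ℝ, E) q →L[ℝ] TangentSpace 𝓘(ℝ, E) q →L[ℝ] ℝ) :=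
    {B | (∀ v w, B v w = B w v) ∧ (∀ v, v ≠ 0 → 0 < B v v) ∧ (q ∈ K → B = chartInner q₀ q)}
  have ht (q : M) : Convex ℝ (t q) := by
    rintro A ⟨hA1, hA2, hA3⟩ B ⟨hB1, hB2, hB3⟩ a b ha hb hab
    refine ⟨fun v w ↦ ?_, fun v hv ↦ ?_, fun hq ↦ ?_⟩
    · simp only [add_apply, smul_apply, hA1 v w, hB1 v w]
    · simp only [add_apply, smul_apply, smul_eq_mul]
      have h1 := hA2 v hv
      have h2 := hB2 v hv
      rcases ha.eq_or_lt with rfl | ha'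
      · obtain rfl : b = 1 := by linarith
        simpa using h2
      · positivity
    · rw [hA3 hq, hB3 hq]
      ext v w
      simp only [add_apply, smul_apply, smul_eq_mul, ← add_mul, hab, one_mul]
  obtain ⟨s, hs⟩ := exists_contMDiffSection_forall_mem_convex_of_local 𝓘(ℝ, E) (n := (⊤ : ℕ∞))
    (F_fiber := E →L[ℝ] E →L[ℝ] ℝ)
    (fun q : M ↦ TangentSpace 𝓘(ℝ, E) q →L[ℝ] TangentSpace 𝓘(ℝ, E) q →L[ℝ] ℝ) t ht (by
      intro q₁
      by_cases hq : q₁ ∈ K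
      · exact ⟨(chartAt E q₀).source, (chartAt E q₀).open_source.mem_nhds (hKs hq),
          fun q ↦ chartInner q₀ q, contMDiffOn_chartInner q₀,
          fun q hq ↦ ⟨hsymm _ _, hpos _ _ hq, fun _ ↦ rfl⟩⟩
      · exact ⟨(chartAt E q₁).source ∩ Kᶜ, Filter.inter_mem
          ((chartAt E q₁).open_source.mem_nhds (mem_chart_source E q₁))
          (hK.isOpen_compl.mem_nhds hq),
          fun q ↦ chartInner q₁ q, (contMDiffOn_chartInner q₁).mono inter_subset_left,
          fun q hq ↦ ⟨hsymm _ _, hpos _ _ hq.1, fun h ↦ absurd h hq.2⟩⟩)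
  exact ⟨{  inner := fun q ↦ s q
            symm := fun q ↦ (hs q).1
            pos := fun q ↦ (hs q).2.1
            isVonNBounded := fun q ↦ isVonNBounded_of_pos (E := E) (s q) (hs q).2.1
            contMDiff := s.contMDiff }, fun q hq v w ↦ by
              simp only [(hs q).2.2 hq, chartInner_apply]⟩

end Metric


/-! ### Velocities in a chart -/

section ChartVelocities

variable {E : Type*} [NormedAddCommGroup E] [NormedSpace ℝ E]
variable {M : Type*} [TopologicalSpace M] [ChartedSpace E M] [IsManifold 𝓘(ℝ, E) ∞ M]

lemma chartDifferential_mfderiv_symm {q₀ : M} {x : E} (hx : x ∈ (chartAt E q₀).target) (v : E) :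
    chartDifferential q₀ ((chartAt E q₀).symm x)
      (mfderiv 𝓘(ℝ, E) 𝓘(ℝ, E) (chartAt E q₀).symm x v) = v := by
  rw [chartDifferential_eq_mfderiv ((chartAt E q₀).map_target hx)]
  have he : MDifferentiableAt 𝓘(ℝ, E) 𝓘(ℝ, E) (chartAt E q₀) ((chartAt E q₀).symm x) :=
    mdifferentiableAt_atlas (chart_mem_atlas E q₀) ((chartAt E q₀).map_target hx)
  have hs : MDifferentiableAt 𝓘(ℝ, E) 𝓘(ℝ, E) (chartAt E q₀).symm x :=
    mdifferentiableAt_atlas_symm (chart_mem_atlas E q₀) hx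
  have h1 := mfderiv_comp x he hs
  have h2 : mfderiv 𝓘(ℝ, E) 𝓘(ℝ, E) (chartAt E q₀ ∘ (chartAt E q₀).symm) x =
      ContinuousLinearMap.id ℝ E := by
    have : (chartAt E q₀ ∘ (chartAt E q₀).symm) =ᶠ[𝓝 x] id := by
      filter_upwards [(chartAt E q₀).open_target.mem_nhds hx] with y hy
      exact (chartAt E q₀).right_inv hy
    rw [this.mfderiv_eq, mfderiv_id]
    rfl
  have h3 := DFunLike.congr_fun (h1.symm.trans h2) v
  exact h3

lemma chartDifferential_mfderivWithin {q₀ : M} {γ : ℝ → M} {J : Set ℝ} {t : ℝ}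
    (hγ : MDifferentiableWithinAt 𝓘(ℝ, ℝ) 𝓘(ℝ, E) γ J t) (hJ : UniqueDiffWithinAt ℝ J t)
    (ht : γ t ∈ (chartAt E q₀).source) :
    chartDifferential q₀ (γ t) (mfderivWithin 𝓘(ℝ, ℝ) 𝓘(ℝ, E) γ J t (1 : ℝ)) =
      derivWithin (chartAt E q₀ ∘ γ) J t := by
  rw [chartDifferential_eq_mfderiv ht]
  have he : MDifferentiableAt 𝓘(ℝ, E) 𝓘(ℝ, E) (chartAt E q₀) (γ t) :=
    mdifferentiableAt_atlas (chart_mem_atlas E q₀) ht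
  have h1 := mfderiv_comp_mfderivWithin t he hγ hJ.uniqueMDiffWithinAt
  rw [mfderivWithin_eq_fderivWithin] at h1
  exact (DFunLike.congr_fun h1 (1 : ℝ)).symm

end ChartVelocities

/-! ### Confinement of orbits in a uniform magnetic field -/

section UniformField

variable {E : Type*} [NormedAddCommGroup E] [InnerProductSpace ℝ E]

lemma hasFDerivAt_half_normSq_add (D : E →L[ℝ] E) (z : E) (v : E) :
    HasFDerivAt (fun w : E ↦ 1 / 2 * ‖D w‖ ^ 2 + ⟪z, D w⟫_ℝ)
      ((innerSL ℝ (D v + z)).comp D) v := by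
  have h1 : HasFDerivAt (fun w : E ↦ ‖D w‖ ^ 2) _ v := D.hasFDerivAt.norm_sq
  have h2 : HasFDerivAt (fun w : E ↦ ⟪z, D w⟫_ℝ) ((innerSL ℝ z).comp D) v :=
    ((innerSL ℝ z).comp D).hasFDerivAt
  refine ((h1.const_mul (1 / 2)).add h2).congr_fderiv ?_
  ext w
  simp

variable {M : Type*} [TopologicalSpace M] [ChartedSpace E M] [IsManifold 𝓘(ℝ, E) ∞ M]

/-- The 1-form is homogeneous of degree one in v, so it cancels from the energy. -/
lemma lagrangianEnergy_eq (L : TangentBundle 𝓘(ℝ, E) M → ℝ) (q₀ q : M) (z : E)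
    (hL : ∀ v : TangentSpace 𝓘(ℝ, E) q, L ⟨q, v⟩ =
      1 / 2 * ‖chartDifferential q₀ q v‖ ^ 2 + ⟪z, chartDifferential q₀ q v⟫_ℝ)
    (v : TangentSpace 𝓘(ℝ, E) q) :
    lagrangianEnergy L ⟨q, v⟩ = 1 / 2 * ‖chartDifferential q₀ q v‖ ^ 2 := by
  have h := (hasFDerivAt_half_normSq_add (E := E) (chartDifferential q₀ q) z v).fderiv
  have h' : fderiv ℝ (fun w : TangentSpace 𝓘(ℝ, E) q ↦ L ⟨q, w⟩) v =
      (innerSL ℝ (chartDifferential (E := E) q₀ q v + z)).comp (chartDifferential (E := E) q₀ q) := by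
    rw [funext hL]
    exact h
  rw [lagrangianEnergy, h', hL]
  simp
  ring

/-- In a region where the metric is Euclidean and the magnetic field is uniform of strength `2b`,
an orbit starting at the centre of a disc of radius `r` cannot leave the disc if its speed is less
than `b r`. -/
theorem not_joinedByOrbitOfEnergy [FiniteDimensional ℝ E] [T2Space M]
    (L : TangentBundle 𝓘(ℝ, E) M → ℝ) (A : E →L[ℝ] E) (hA : ∀ x, ‖A x‖ = ‖x‖)
    (hA' : ∀ x y, ⟪A x, y⟫_ℝ = -⟪x, A y⟫_ℝ) (q₀ : M) {r b k : ℝ} (hb : 0 < b) (hr : 0 < r)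
    (hball : Metric.ball (chartAt E q₀ q₀) r ⊆ (chartAt E q₀).target)
    (hL : ∀ x ∈ Metric.ball (chartAt E q₀ q₀) r,
      ∀ v : TangentSpace 𝓘(ℝ, E) ((chartAt E q₀).symm x), L ⟨(chartAt E q₀).symm x, v⟩ =
        1 / 2 * ‖chartDifferential q₀ _ v‖ ^ 2 +
          ⟪b • A (x - chartAt E q₀ q₀), chartDifferential q₀ _ v⟫_ℝ)
    (hk : 2 * k < (b * r) ^ 2) {q₁ : M}
    (hq₁ : q₁ ∉ (chartAt E q₀).symm '' Metric.ball (chartAt E q₀ q₀) r) :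
    ¬ JoinedByOrbitOfEnergy L k q₀ q₁ := by
  rintro ⟨T, γ, hT, h0, h1, ⟨hγ, hEL⟩, hen⟩
  set e := chartAt E q₀ with he
  set c := e q₀ with hc
  set W := e.symm '' Metric.ball c r with hW
  have hWo : IsOpen W := e.isOpen_image_symm_of_subset_target Metric.isOpen_ball hball
  have hWs : ∀ q ∈ W, q ∈ e.source ∧ e q ∈ Metric.ball c r := by
    rintro _ ⟨x, hx, rfl⟩
    exact ⟨e.map_target (hball hx), by rwa [e.right_inv (hball hx)]⟩
  have hLW : ∀ q ∈ W, ∀ v : TangentSpace 𝓘(ℝ, E) q, L ⟨q, v⟩ =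
      1 / 2 * ‖chartDifferential q₀ q v‖ ^ 2 +
        ⟪b • A (e q - c), chartDifferential q₀ q v⟫_ℝ := by
    rintro _ ⟨x, hx, rfl⟩ v
    rw [hL x hx v, e.right_inv (hball hx)]
  have hq₀W : q₀ ∈ W := ⟨c, Metric.mem_ball_self hr, e.left_inv (mem_chart_source E q₀)⟩
  set Z := Icc 0 T ∩ γ ⁻¹' Wᶜ with hZ
  have hZc : IsCompact Z := isCompact_Icc.of_isClosed_subset
    (hγ.continuousOn.preimage_isClosed_of_isClosed isClosed_Icc hWo.isClosed_compl)
    inter_subset_left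
  have hZT : T ∈ Z := ⟨⟨hT.le, le_rfl⟩, by rw [mem_preimage, h1]; exact hq₁⟩
  -- τ is the first time at which the orbit is outside the open disc W.
  have hτ : sInf Z ∈ Z := hZc.sInf_mem ⟨T, hZT⟩
  set τ := sInf Z with hτdef
  have hτ0 : 0 < τ := by
    rcases hτ.1.1.eq_or_lt with h | h
    · exact absurd hq₀W (by rw [← h0, h]; exact hτ.2)
    · exact h
  have hlt : ∀ t ∈ Ico 0 τ, γ t ∈ W := by
    intro t ht
    by_contra hn
    exact absurd (csInf_le hZc.bddBelow (⟨⟨ht.1, ht.2.le.trans hτ.1.2⟩, hn⟩ : t ∈ Z))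
      (not_le.2 ht.2)
  have hIco : Ico 0 τ ⊆ Icc 0 T := fun t ht ↦ ⟨ht.1, ht.2.le.trans hτ.1.2⟩
  have hIco' : ∀ t ∈ Ico 0 τ, t < T := fun t ht ↦ ht.2.trans_le hτ.1.2
  have huniq : UniqueDiffOn ℝ (Icc 0 T) := uniqueDiffOn_Icc hT
  set x : ℝ → E := e ∘ γ with hx
  set v : ℝ → E := derivWithin x (Icc 0 T) with hv
  have hmax : e ∈ IsManifold.maximalAtlas 𝓘(ℝ, E) ∞ M := IsManifold.chart_mem_maximalAtlas q₀
  have hxd : ∀ t ∈ Ico 0 τ, HasDerivWithinAt x (v t) (Icc 0 T) t := by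
    intro t ht
    have h2 : MDifferentiableWithinAt 𝓘(ℝ, ℝ) 𝓘(ℝ, E) γ (Icc 0 T) t :=
      (hγ t (hIco ht)).mdifferentiableWithinAt (by norm_num)
    have h3 : MDifferentiableAt 𝓘(ℝ, E) 𝓘(ℝ, E) e (γ t) :=
      mdifferentiableAt_atlas (chart_mem_atlas E q₀) (hWs _ (hlt t ht)).1
    exact (h3.comp_mdifferentiableWithinAt t h2).differentiableWithinAt.hasDerivWithinAt
  have hspeed : ∀ t ∈ Ico 0 τ, ‖v t‖ ^ 2 = 2 * k := by
    intro t ht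
    have h2 := hen t (hIco ht)
    rw [lagrangianEnergy_eq L q₀ (γ t) _ (hLW _ (hlt t ht)),
      chartDifferential_mfderivWithin ((hγ t (hIco ht)).mdifferentiableWithinAt (by norm_num))
        (huniq t (hIco ht)) (hWs _ (hlt t ht)).1] at h2
    change 1 / 2 * ‖v t‖ ^ 2 = k at h2
    linarith
  have hloc : ∀ y ∈ Metric.ball c r, ∀ w, localLagrangian L e y w =
      1 / 2 * ‖w‖ ^ 2 + ⟪b • A (y - c), w⟫_ℝ := by
    intro y hy w
    rw [localLagrangian, hL y hy, chartDifferential_mfderiv_symm (hball hy)]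
  have hmom : ∀ s, γ s ∈ W →
      fderiv ℝ (fun w ↦ localLagrangian L e (e (γ s)) w) (v s) =
        innerSL ℝ (v s + b • A (x s - c)) := by
    intro s hs
    rw [funext (hloc _ (hWs _ hs).2)]
    exact (hasFDerivAt_half_normSq_add (ContinuousLinearMap.id ℝ E) _ (v s)).fderiv
  -- By skewness of A, the Lagrangian at fixed velocity is affine in the position, with constant
  -- gradient -b A v.
  have hforce : ∀ s, γ s ∈ W → ∀ w,
      fderiv ℝ (fun y ↦ localLagrangian L e y (v s)) (e (γ s)) w = -⟪b • A (v s), w⟫_ℝ := by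
    intro s hs w
    have h2 : (fun y ↦ localLagrangian L e y (v s)) =ᶠ[𝓝 (e (γ s))]
        fun y ↦ 1 / 2 * ‖v s‖ ^ 2 + ⟪b • A (y - c), v s⟫_ℝ := by
      filter_upwards [Metric.isOpen_ball.mem_nhds (hWs _ hs).2] with y hy
      exact hloc y hy _
    have h3 : HasFDerivAt (fun y ↦ 1 / 2 * ‖v s‖ ^ 2 + ⟪b • A (y - c), v s⟫_ℝ)
        (-(innerSL ℝ (b • A (v s)))) (e (γ s)) := by
      have h4 : (fun y ↦ 1 / 2 * ‖v s‖ ^ 2 + ⟪b • A (y - c), v s⟫_ℝ) =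
          fun y ↦ (-(innerSL ℝ (b • A (v s)))) y +
            (1 / 2 * ‖v s‖ ^ 2 + ⟪b • A (v s), c⟫_ℝ) := by
        funext y
        simp only [inner_smul_left, hA', real_inner_comm (A (v s)),
          neg_apply, innerSL_apply_apply, map_sub, inner_sub_left]
        simp
        ring
      rw [h4]
      exact (-(innerSL ℝ (b • A (v s)))).hasFDerivAt.add_const _
    rw [h2.fderiv_eq, h3.fderiv, neg_apply, innerSL_apply_apply]
  -- The Euler-Lagrange equation says that v + bA(x - c) has derivative -bAv; adding bA(x - c) once
  -- more gives a conserved quantity.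
  have hcons : ∀ t ∈ Ico 0 τ, v t + (2 * b) • A (x t - c) = v 0 := by
    intro t₁ ht₁
    refine ext_inner_right ℝ fun w ↦ ?_
    set P : ℝ → ℝ := fun s ↦ ⟪v s + (2 * b) • A (x s - c), w⟫_ℝ with hP
    have hd : ∀ t ∈ Ico 0 τ, HasDerivWithinAt P 0 (Icc 0 T) t := by
      intro t ht
      have h2 := hEL e hmax t (hIco ht) (hWs _ (hlt t ht)).1
      have h3 := (h2.clm_apply (hasDerivWithinAt_const t (Icc 0 T) w))
      have hev : ∀ᶠ s in 𝓝[Icc 0 T] t, γ s ∈ W :=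
        (hγ.continuousOn t (hIco ht)) (hWo.mem_nhds (hlt t ht))
      have h4 : HasDerivWithinAt (fun s ↦ ⟪v s + b • A (x s - c), w⟫_ℝ)
          (-⟪b • A (v t), w⟫_ℝ) (Icc 0 T) t := by
        refine (h3.congr_of_eventuallyEq ?_ ?_).congr_deriv ?_
        · filter_upwards [hev] with s hs
          rw [hmom s hs, innerSL_apply_apply]
        · rw [hmom t (hlt t ht), innerSL_apply_apply]
        · rw [← hforce t (hlt t ht) w]
          simp
          rfl
      have h5 : HasDerivWithinAt (fun s ↦ ⟪b • A (x s - c), w⟫_ℝ)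
          ⟪b • A (v t), w⟫_ℝ (Icc 0 T) t := by
        have := ((((A.hasFDerivAt.comp_hasDerivWithinAt t ((hxd t ht).sub_const c))).const_smul
          b).inner ℝ (hasDerivWithinAt_const t (Icc 0 T) w))
        simpa using this
      refine ((h4.add h5).congr_of_eventuallyEq ?_ ?_).congr_deriv (by simp)
      · refine Filter.Eventually.of_forall fun s ↦ ?_
        simp only [hP, Pi.add_apply, ← inner_add_left]
        congr 1
        module
      · simp only [hP, Pi.add_apply, ← inner_add_left]
        congr 1
        module
    have hsub : Icc 0 t₁ ⊆ Ico 0 τ := fun s hs ↦ ⟨hs.1, hs.2.trans_lt ht₁.2⟩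
    -- Right derivatives suffice, and since s < T the interval [s, T] is a neighbourhood of s within
    -- [s, ∞).
    have h6 := constant_of_has_deriv_right_zero (f := P) (a := 0) (b := t₁)
      (fun s hs ↦ ((hd s (hsub hs)).continuousWithinAt.mono (hsub.trans hIco)))
      (fun s hs ↦ (hd s (hsub (Ico_subset_Icc_self hs))).mono_of_mem_nhdsWithin
        (Filter.mem_of_superset (Icc_mem_nhdsGE (hIco' s (hsub (Ico_subset_Icc_self hs))))
          (Icc_subset_Icc_left hs.1))) t₁ ⟨ht₁.1, le_rfl⟩
    simp only [hP] at h6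
    rw [h6]
    simp [hx, h0, hc]
  have hdist : ∀ t ∈ Ico 0 τ, x t ∈ Metric.closedBall c (√(2 * k) / b) := by
    intro t ht
    have hn : ∀ s ∈ Ico 0 τ, ‖v s‖ = √(2 * k) := fun s hs ↦ by
      rw [← hspeed s hs, Real.sqrt_sq (norm_nonneg _)]
    have h2 : (2 * b) • A (x t - c) = v 0 - v t := by rw [← hcons t ht]; abel
    have h3 : 2 * b * ‖x t - c‖ ≤ 2 * √(2 * k) := by
      calc 2 * b * ‖x t - c‖ = ‖(2 * b) • A (x t - c)‖ := by
            rw [norm_smul, hA, Real.norm_of_nonneg (by positivity)]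
        _ ≤ ‖v 0‖ + ‖v t‖ := by rw [h2]; exact norm_sub_le _ _
        _ = 2 * √(2 * k) := by rw [hn t ht, hn 0 ⟨le_rfl, hτ0⟩]; ring
    rw [mem_closedBall_iff_norm, le_div_iff₀ hb]
    linarith
  have hρ : √(2 * k) / b < r := by
    rw [div_lt_iff₀ hb, Real.sqrt_lt' (by positivity), mul_comm r b]
    exact hk
  have hsub : Metric.closedBall c (√(2 * k) / b) ⊆ Metric.ball c r :=
    Metric.closedBall_subset_ball hρ
  have hK : IsClosed (e.symm '' Metric.closedBall c (√(2 * k) / b)) :=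
    ((isCompact_closedBall _ _).image_of_continuousOn
      (e.continuousOn_symm.mono (hsub.trans hball))).isClosed
  -- Before τ the orbit stays in the image of a strictly smaller closed disc. That image is closed,
  -- so it also contains γ τ, contradicting the choice of τ.
  refine hτ.2 (image_mono hsub (?_ : γ τ ∈ _))
  have hne : (𝓝[Ico 0 τ] τ).NeBot := by
    rw [← mem_closure_iff_nhdsWithin_neBot, closure_Ico hτ0.ne]
    exact ⟨hτ0.le, le_rfl⟩
  refine hK.mem_of_tendsto ((hγ.continuousOn τ hτ.1).mono hIco) ?_
  filter_upwards [self_mem_nhdsWithin] with t ht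
  exact ⟨x t, hdist t ht, e.left_inv (hWs _ (hlt t ht)).1⟩

end UniformField


/-! ### Bounds and test loops for the critical value -/

section ManeValue

variable {E : Type*} [NormedAddCommGroup E] [NormedSpace ℝ E]
variable {M : Type*} [TopologicalSpace M] [ChartedSpace E M]

lemma maneCriticalValueUniversal_le {L : TangentBundle 𝓘(ℝ, E) M → ℝ} {k : ℝ}
    (hL : ∀ p, 0 ≤ L p + k) : maneCriticalValueUniversal L ≤ (k : EReal) := by
  refine sInf_le ⟨k, fun q x T hT _ _ ↦ ?_, rfl⟩
  exact mul_nonneg hT.le (intervalIntegral.integral_nonneg zero_le_one fun s _ ↦ hL _)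

/-- In a chart, a C¹ curve is Lipschitz with bounded derivative on a compact interval. Agreement on
[0, 1] only is what `Path.extend` offers. -/
lemma isH1Curve_of_contMDiff {γ x : ℝ → M} (hγ : ContMDiff 𝓘(ℝ, ℝ) 𝓘(ℝ, E) 1 γ)
    (hx : EqOn x γ (Icc 0 1)) : IsH1Curve E x := by
  refine ⟨hγ.continuous.continuousOn.congr hx, fun e he a b ha hab hb hmaps ↦ ?_⟩
  have hsub : Icc a b ⊆ Icc 0 1 := Icc_subset_Icc ha hb
  have heq : EqOn (e ∘ x) (e ∘ γ) (Icc a b) := fun s hs ↦ congrArg e (hx (hsub hs))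
  have hsmooth : ∀ s ∈ Icc a b, ContDiffAt ℝ 1 (e ∘ γ) s := by
    intro s hs
    have h1 : ContMDiffAt 𝓘(ℝ, E) 𝓘(ℝ, E) 1 e (γ s) :=
      (contMDiffAt_of_mem_maximalAtlas he (by rw [← hx (hsub hs)]; exact hmaps hs)).of_le
        (by norm_num)
    exact (h1.comp s (hγ s)).contDiffAt
  have hon : ContDiffOn ℝ 1 (e ∘ γ) (Icc a b) := fun s hs ↦ (hsmooth s hs).contDiffWithinAt
  have hdc : ContinuousOn (deriv (e ∘ γ)) (Icc a b) := fun s hs ↦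
    (((hsmooth s hs).fderiv_right (m := 0) (by simp)).continuousAt.clm_apply
      (continuousAt_const (y := (1 : ℝ)))).continuousWithinAt
  obtain ⟨K, hK⟩ := hon.exists_lipschitzOnWith one_ne_zero (convex_Icc a b) isCompact_Icc
  constructor
  · refine LipschitzOnWith.absolutelyContinuousOnInterval (K := K) ?_
    rw [uIcc_of_le hab]
    exact fun s hs t ht ↦ by simpa only [heq hs, heq ht] using hK hs ht
  · obtain ⟨C, hC⟩ := isCompact_Icc.exists_bound_of_continuousOn hdc
    have h2 : MemLp (deriv (e ∘ γ)) 2 (volume.restrict (Ioo a b)) :=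
      MemLp.of_bound ((hdc.mono Ioo_subset_Icc_self).aestronglyMeasurable measurableSet_Ioo) C
        ((ae_restrict_mem measurableSet_Ioo).mono fun s hs ↦ hC s (Ioo_subset_Icc_self hs))
    refine h2.ae_eq ((ae_restrict_mem measurableSet_Ioo).mono fun s hs ↦ ?_)
    refine Filter.EventuallyEq.deriv_eq ?_
    filter_upwards [Icc_mem_nhds hs.1 hs.2] with t ht
    exact (heq ht).symm

end ManeValue

/-- A loop which is the image of a loop in a convex subset of a vector space is contractible. -/
lemma homotopic_refl_of_convex {E M : Type*} [NormedAddCommGroup E] [NormedSpace ℝ E]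
    [TopologicalSpace M] {C : Set E} (hC : Convex ℝ C) {f : E → M} (hf : ContinuousOn f C)
    {q : M} (x : Path q q) {y : ℝ → E} (hy : Continuous y) (hyC : ∀ s, y s ∈ C) (hy01 : y 0 = y 1)
    (hx : ∀ s : unitInterval, x s = f (y s)) : x.Homotopic (Path.refl q) := by
  have : ContractibleSpace C := hC.contractibleSpace ⟨y 0, hyC 0⟩
  let p : Path (⟨y 0, hyC 0⟩ : C) ⟨y 0, hyC 0⟩ :=
    { toFun := fun s ↦ ⟨y s, hyC s⟩
      continuous_toFun := by fun_prop
      source' := by simp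
      target' := by simp [hy01] }
  have hq : q = C.domRestrict f ⟨y 0, hyC 0⟩ := by
    have := hx 0
    rw [x.source] at this
    exact this
  subst hq
  have h1 := (SimplyConnectedSpace.paths_homotopic p (Path.refl _)).map
    ⟨C.domRestrict f, hf.domRestrict⟩
  convert! h1 using 1
  ext s
  exact hx s

/-! ### The circle as a test loop -/

section Circle

variable {E : Type*} [NormedAddCommGroup E] [InnerProductSpace ℝ E]

/-- The circle about the origin through `u`, with period `1`, in the plane spanned by `u` and
`A u`. -/
noncomputable def rotationCircle (A : E →L[ℝ] E) (u : E) (s : ℝ) : E :=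
  Real.cos (2 * Real.pi * s) • u - Real.sin (2 * Real.pi * s) • A u

lemma contDiff_rotationCircle (A : E →L[ℝ] E) (u : E) : ContDiff ℝ 1 (rotationCircle A u) := by
  unfold rotationCircle
  fun_prop

/-- The minus sign is the point: the circle runs against the form ⟨A x, ·⟩, so the magnetic term
lowers its action. -/
lemma hasDerivAt_rotationCircle {A : E →L[ℝ] E} (hAA : ∀ x, A (A x) = -x) (u : E) (s : ℝ) :
    HasDerivAt (rotationCircle A u) (-(2 * Real.pi) • A (rotationCircle A u s)) s := by
  have h0 : HasDerivAt (fun s : ℝ ↦ 2 * Real.pi * s) (2 * Real.pi) s := by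
    simpa using (hasDerivAt_id s).const_mul (2 * Real.pi)
  have := (h0.cos.smul_const u).sub (h0.sin.smul_const (A u))
  refine this.congr_deriv ?_
  simp only [rotationCircle, map_sub, map_smul, hAA]
  module

lemma norm_rotationCircle {A : E →L[ℝ] E} (hA : ∀ x, ‖A x‖ = ‖x‖)
    (hA' : ∀ x y, ⟪A x, y⟫_ℝ = -⟪x, A y⟫_ℝ) (u : E) (s : ℝ) : ‖rotationCircle A u s‖ = ‖u‖ := by
  have h0 : ⟪u, A u⟫_ℝ = 0 := by
    have := hA' u u
    rw [real_inner_comm] at this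
    linarith
  rw [← sq_eq_sq₀ (norm_nonneg _) (norm_nonneg _), rotationCircle, norm_sub_sq_real]
  simp only [norm_smul, inner_smul_left, inner_smul_right, h0, hA, mul_pow, Real.norm_eq_abs,
    sq_abs]
  have := Real.sin_sq_add_cos_sq (2 * Real.pi * s)
  linear_combination ‖u‖ ^ 2 * this

variable {M : Type*} [TopologicalSpace M] [ChartedSpace E M] [IsManifold 𝓘(ℝ, E) ∞ M]

/-- In a region where the metric is Euclidean and the magnetic field is uniform of strength `2b`,
the circle of radius `r` traversed with speed `b r` bounds the Mañé critical value from below. -/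
theorem le_maneCriticalValueUniversal [Nontrivial E] (L : TangentBundle 𝓘(ℝ, E) M → ℝ)
    (A : E →L[ℝ] E) (hA : ∀ x, ‖A x‖ = ‖x‖) (hA' : ∀ x y, ⟪A x, y⟫_ℝ = -⟪x, A y⟫_ℝ)
    (hAA : ∀ x, A (A x) = -x) (q₀ : M) {r b : ℝ} (hb : 0 < b) (hr : 0 < r)
    (hball : Metric.closedBall (chartAt E q₀ q₀) r ⊆ (chartAt E q₀).target)
    (hL : ∀ x ∈ Metric.closedBall (chartAt E q₀ q₀) r,
      ∀ v : TangentSpace 𝓘(ℝ, E) ((chartAt E q₀).symm x), L ⟨(chartAt E q₀).symm x, v⟩ =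
        1 / 2 * ‖chartDifferential q₀ _ v‖ ^ 2 +
          ⟪b • A (x - chartAt E q₀ q₀), chartDifferential q₀ _ v⟫_ℝ) :
    (((b * r) ^ 2 / 2 : ℝ) : EReal) ≤ maneCriticalValueUniversal L := by
  refine le_sInf ?_
  rintro _ ⟨k, hk, rfl⟩
  rw [EReal.coe_le_coe_iff]
  set e := chartAt E q₀ with he
  set c := e q₀ with hc
  obtain ⟨u, hu⟩ : ∃ u : E, ‖u‖ = r := exists_norm_eq E hr.le
  set y : ℝ → E := fun s ↦ c + rotationCircle A u s with hy
  have hys : ContDiff ℝ 1 y := contDiff_const.add (contDiff_rotationCircle A u)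
  have hyC : ∀ s, y s ∈ Metric.closedBall c r := fun s ↦ by
    simp [hy, norm_rotationCircle hA hA', hu]
  have hy01 : y 0 = y 1 := by simp [hy, rotationCircle]
  have hyd : ∀ s, HasDerivAt y (-(2 * Real.pi) • A (y s - c)) s := fun s ↦ by
    simpa [hy] using (hasDerivAt_rotationCircle hAA u s).const_add c
  set γ : ℝ → M := e.symm ∘ y with hγ
  have hγs : ContMDiff 𝓘(ℝ, ℝ) 𝓘(ℝ, E) 1 γ := by
    have h1 : ContMDiffOn 𝓘(ℝ, E) 𝓘(ℝ, E) 1 e.symm e.target :=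
      (contMDiffOn_chart_symm (n := ∞)).of_le (by norm_num)
    exact h1.comp_contMDiff hys.contMDiff fun s ↦ hball (hyC s)
  let x : Path (γ 0) (γ 0) :=
    { toFun := fun s ↦ γ s
      continuous_toFun := hγs.continuous.comp continuous_subtype_val
      source' := by simp
      target' := by simp [hγ, hy01] }
  have hxγ : EqOn x.extend γ (Icc 0 1) := fun s hs ↦ by
    rw [Path.extend_apply _ hs]
    rfl
  -- This period gives the circle of radius r the speed b r.
  have hT : 0 < 2 * Real.pi / b := by positivity
  have hact := hk (γ 0) x (2 * Real.pi / b) hT (isH1Curve_of_contMDiff hγs hxγ)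
    (homotopic_refl_of_convex (convex_closedBall c r) (e.continuousOn_symm.mono hball) x
      hys.continuous hyC hy01 fun s ↦ rfl)
  -- The endpoints are left out because `Path.extend` is constant outside [0, 1] and need not be
  -- differentiable there; they have measure zero.
  have hint : ∀ s ∈ Ioo (0 : ℝ) 1, L ⟨x.extend s, (2 * Real.pi / b)⁻¹ •
      mfderiv 𝓘(ℝ, ℝ) 𝓘(ℝ, E) x.extend s (1 : ℝ)⟩ + k = k - (b * r) ^ 2 / 2 := by
    intro s hs
    have hev : x.extend =ᶠ[𝓝 s] γ := by
      filter_upwards [Icc_mem_nhds hs.1 hs.2] with t ht using hxγ ht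
    have hxs : x.extend s = e.symm (y s) := hev.eq_of_nhds
    have hsrc : x.extend s ∈ e.source := by
      rw [hxs]
      exact e.map_target (hball (hyC s))
    have hLx : ∀ w : TangentSpace 𝓘(ℝ, E) (x.extend s), L ⟨x.extend s, w⟩ =
        1 / 2 * ‖chartDifferential q₀ _ w‖ ^ 2 +
          ⟪b • A (y s - c), chartDifferential q₀ _ w⟫_ℝ := by
      rw [hxs]
      exact hL (y s) (hyC s)
    have hvel : chartDifferential q₀ (x.extend s)
        (mfderiv 𝓘(ℝ, ℝ) 𝓘(ℝ, E) x.extend s (1 : ℝ)) = -(2 * Real.pi) • A (y s - c) := by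
      have hd : MDifferentiableAt 𝓘(ℝ, ℝ) 𝓘(ℝ, E) x.extend s :=
        ((hγs s).congr_of_eventuallyEq hev).mdifferentiableAt one_ne_zero
      have h5 := chartDifferential_mfderivWithin (q₀ := q₀) (J := univ) (t := s)
        hd.mdifferentiableWithinAt uniqueDiffWithinAt_univ hsrc
      rw [mfderivWithin_univ, derivWithin_univ] at h5
      rw [h5, ← (hyd s).deriv]
      refine Filter.EventuallyEq.deriv_eq ?_
      filter_upwards [hev] with t ht
      rw [Function.comp_apply, ht]
      exact e.right_inv (hball (hyC t))
    have hnorm : ‖A (y s - c)‖ = r := by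
      rw [hA]
      simp [hy, norm_rotationCircle hA hA', hu]
    have hscale : (2 * Real.pi / b)⁻¹ * -(2 * Real.pi) = -b := by
      field_simp
    generalize mfderiv 𝓘(ℝ, ℝ) 𝓘(ℝ, E) x.extend s (1 : ℝ) = w at hvel
    rw [hLx, map_smul, hvel, smul_smul, hscale, norm_smul, inner_smul_left, inner_smul_right,
      real_inner_self_eq_norm_sq, hnorm, norm_neg, Real.norm_of_nonneg hb.le]
    simp
    ring
  rw [freeTimeAction, intervalIntegral.integral_of_le zero_le_one,
    integral_Ioc_eq_integral_Ioo, setIntegral_congr_fun measurableSet_Ioo hint] at hact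
  simp only [integral_const, smul_eq_mul] at hact
  have := nonneg_of_mul_nonneg_right (nonneg_of_mul_nonneg_right hact hT) (by simp)
  linarith

end Circle


/-! ### Construction of the Lagrangian -/

section Construction

variable {E : Type*} [NormedAddCommGroup E] [InnerProductSpace ℝ E] [FiniteDimensional ℝ E]
variable {M : Type*} [TopologicalSpace M] [ChartedSpace E M] [IsManifold 𝓘(ℝ, E) ∞ M]

/-- A magnetic Lagrangian whose metric is Euclidean over a small disc in a chart and whose 1-form,
supported in the disc and of norm at most `1`, has norm `s` on the boundary of a smaller disc on
which the magnetic field is uniform. -/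
theorem exists_magneticLagrangian [T2Space M] [SigmaCompactSpace M]
    (A : E →L[ℝ] E) (hA : ∀ x, ‖A x‖ = ‖x‖) (q₀ : M) {s : ℝ} (hs0 : 0 < s) (hs1 : s < 1) :
    ∃ (L : TangentBundle 𝓘(ℝ, E) M → ℝ) (r b : ℝ), IsMagneticLagrangian L ∧
      (∀ p, 0 ≤ L p + 1 / 2) ∧ 0 < b ∧ 0 < r ∧ b * r = s ∧
      Metric.closedBall (chartAt E q₀ q₀) r ⊆ (chartAt E q₀).target ∧
      ∀ x ∈ Metric.closedBall (chartAt E q₀ q₀) r,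
        ∀ v : TangentSpace 𝓘(ℝ, E) ((chartAt E q₀).symm x), L ⟨(chartAt E q₀).symm x, v⟩ =
          1 / 2 * ‖chartDifferential q₀ _ v‖ ^ 2 +
            ⟪b • A (x - chartAt E q₀ q₀), chartDifferential q₀ _ v⟫_ℝ := by
  set e := chartAt E q₀ with he
  set c := e q₀ with hc
  obtain ⟨R, hR, hball⟩ : ∃ R : ℝ, 0 < R ∧ Metric.closedBall c R ⊆ e.target :=
    Metric.nhds_basis_closedBall.mem_iff.1
      (e.open_target.mem_nhds (e.map_source (mem_chart_source E q₀)))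
  have hsR : s * R < R := by nlinarith
  set K : Set M := e.symm '' Metric.closedBall c R with hK
  have hKc : IsClosed K :=
    ((isCompact_closedBall c R).image_of_continuousOn (e.continuousOn_symm.mono hball)).isClosed
  have hKs : K ⊆ e.source := by
    rintro _ ⟨x, hx, rfl⟩
    exact e.map_target (hball hx)
  obtain ⟨g, hg⟩ := exists_riemannianMetric_eq_chartInner q₀ hKc hKs
  let ψ : ContDiffBump c := ⟨s * R, R, by positivity, hsR⟩
  obtain ⟨B, hB⟩ : ∃ B : E →L[ℝ] E →L[ℝ] ℝ, ∀ v w, B v w = ⟪v, w⟫_ℝ :=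
    ⟨innerSL ℝ, fun _ _ ↦ rfl⟩
  set a : E → E →L[ℝ] ℝ := fun x ↦ (ψ x * R⁻¹) • B (A (x - c)) with ha
  have has : ContDiff ℝ ∞ a := by
    have hψ : ContDiff ℝ ∞ ψ := ψ.contDiff
    exact (hψ.mul contDiff_const).smul
      (B.contDiff.comp (A.contDiff.comp (contDiff_id.sub contDiff_const)))
  have haK : ∀ x ∉ Metric.closedBall c R, a x = 0 := by
    intro x hx
    have : ψ x = 0 := ψ.zero_of_le_dist (by simpa using (not_le.1 hx).le)
    simp [ha, this]
  set θ : ∀ q : M, TangentSpace 𝓘(ℝ, E) q →L[ℝ] ℝ :=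
    fun q ↦ (a (e q)).comp (chartDifferential q₀ q) with hθ
  have hθs : IsSmoothOneForm θ :=
    isSmoothOneForm_pullback q₀ a has (isCompact_closedBall c R) hball haK
  set L : TangentBundle 𝓘(ℝ, E) M → ℝ :=
    fun p ↦ 1 / 2 * g.inner p.1 p.2 p.2 + θ p.1 p.2 with hL
  have hLK : ∀ x ∈ Metric.closedBall c R, ∀ v : TangentSpace 𝓘(ℝ, E) (e.symm x),
      L ⟨e.symm x, v⟩ = 1 / 2 * ‖chartDifferential q₀ _ v‖ ^ 2 +
        ψ x * R⁻¹ * ⟪A (x - c), chartDifferential q₀ _ v⟫_ℝ := by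
    intro x hx v
    have h1 : θ (e.symm x) v = ψ x * R⁻¹ * ⟪A (x - c), chartDifferential q₀ _ v⟫_ℝ := by
      simp only [hθ, ha, ContinuousLinearMap.comp_apply, smul_apply, hB, e.right_inv (hball hx),
        smul_eq_mul]
    simp only [hL]
    rw [h1, hg _ ⟨x, hx, rfl⟩, real_inner_self_eq_norm_sq]
  refine ⟨L, s * R, R⁻¹, ⟨g, θ, hθs, fun q v ↦ rfl⟩, ?_, by positivity, by positivity,
    by field_simp, (Metric.closedBall_subset_closedBall hsR.le).trans hball, ?_⟩
  · rintro ⟨q, v⟩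
    by_cases hq : q ∈ K
    · obtain ⟨x, hx, rfl⟩ := hq
      rw [hLK x hx v]
      set w := chartDifferential q₀ _ v with hw
      have h1 : |ψ x * R⁻¹ * ⟪A (x - c), w⟫_ℝ| ≤ ‖w‖ := by
        have h2 : |⟪A (x - c), w⟫_ℝ| ≤ R * ‖w‖ := by
          refine (abs_real_inner_le_norm _ _).trans ?_
          rw [hA]
          gcongr
          exact mem_closedBall_iff_norm.1 hx
        rw [abs_mul, abs_of_nonneg (mul_nonneg ψ.nonneg (inv_nonneg.2 hR.le))]
        calc ψ x * R⁻¹ * |⟪A (x - c), w⟫_ℝ| ≤ 1 * R⁻¹ * (R * ‖w‖) := by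
              gcongr
              exact ψ.le_one
          _ = ‖w‖ := by field_simp
      -- ‖w‖²/2 - ‖w‖ + 1/2 = (‖w‖ - 1)²/2.
      nlinarith [neg_le_of_abs_le h1, sq_nonneg (‖w‖ - 1)]
    · have h1 : θ q = 0 := by
        by_cases hqs : q ∈ e.source
        · have : a (e q) = 0 := haK _ fun h ↦ hq ⟨_, h, e.left_inv hqs⟩
          simp only [hθ, this, ContinuousLinearMap.zero_comp]
        · simp only [hθ, chartDifferential_eq_zero hqs, ContinuousLinearMap.comp_zero]
      have h2 : 0 ≤ g.inner q v v := by
        rcases eq_or_ne v 0 with rfl | hv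
        · simp
        · exact (g.pos q v hv).le
      simp only [hL, h1, zero_apply]
      linarith
  · intro x hx v
    have h1 : ψ x = 1 := ψ.one_of_mem_closedBall hx
    rw [hLK x (Metric.closedBall_subset_closedBall hsR.le hx), h1, one_mul, inner_smul_left]
    simp

/-- The statement of the main theorem for manifolds modelled on a Euclidean space with an
orthogonal complex structure `A`. -/
theorem exists_magneticLagrangian_not_joined [Nontrivial E] [T2Space M] [SigmaCompactSpace M]
    [Nonempty M] (A : E →L[ℝ] E) (hA : ∀ x, ‖A x‖ = ‖x‖)
    (hA' : ∀ x y, ⟪A x, y⟫_ℝ = -⟪x, A y⟫_ℝ) (hAA : ∀ x, A (A x) = -x) {ε : ℝ} (hε : 0 < ε) :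
    ∃ L : TangentBundle 𝓘(ℝ, E) M → ℝ, IsMagneticLagrangian L ∧
      maneCriticalValueUniversal L ∈ Set.Icc ((1 / 2 - ε : ℝ) : EReal) ((1 / 2 : ℝ) : EReal) ∧
      ∃ q₀ q₁ : M, q₀ ≠ q₁ ∧ ∀ k : ℝ, k < 1 / 2 - ε → ¬ JoinedByOrbitOfEnergy L k q₀ q₁ := by
  obtain ⟨q₀⟩ := ‹Nonempty M›
  -- Shrinking ε below 1/2 keeps s = √(1 - 2δ) positive, and s²/2 = 1/2 - δ.
  obtain ⟨δ, hδ, hδε, hδ2⟩ : ∃ δ : ℝ, 0 < δ ∧ δ ≤ ε ∧ δ < 1 / 2 :=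
    ⟨min ε (1 / 4), by positivity, min_le_left _ _, (min_le_right _ _).trans_lt (by norm_num)⟩
  have hs0 : 0 < √(1 - 2 * δ) := Real.sqrt_pos.2 (by linarith)
  have hs1 : √(1 - 2 * δ) < 1 := by
    rw [Real.sqrt_lt' one_pos]
    linarith
  have hsq : √(1 - 2 * δ) ^ 2 = 1 - 2 * δ := Real.sq_sqrt (by linarith)
  obtain ⟨L, r, b, hLm, hL1, hb, hr, hbr, hball, hL⟩ :=
    exists_magneticLagrangian A hA q₀ hs0 hs1
  rw [← hbr] at hsq
  refine ⟨L, hLm, ⟨le_trans ?_ (le_maneCriticalValueUniversal L A hA hA' hAA q₀ hb hr hball hL),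
    maneCriticalValueUniversal_le hL1⟩, ?_⟩
  · rw [EReal.coe_le_coe_iff, hsq]
    linarith
  obtain ⟨u, hu⟩ : ∃ u : E, ‖u‖ = r := exists_norm_eq E hr.le
  set e := chartAt E q₀ with he
  -- The target q₁ lies on the boundary circle of the inner disc.
  have huR : e q₀ + u ∈ Metric.closedBall (e q₀) r := by simp [hu]
  have hq₁ : e.symm (e q₀ + u) ∉ e.symm '' Metric.ball (e q₀) r := by
    rintro ⟨x, hx, hxu⟩
    rw [e.symm.injOn (hball (Metric.ball_subset_closedBall hx)) (hball huR) hxu] at hx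
    simp [hu] at hx
  refine ⟨q₀, e.symm (e q₀ + u), ?_, fun k hk ↦ ?_⟩
  · intro h
    exact hq₁ (h ▸ ⟨e q₀, Metric.mem_ball_self hr, e.left_inv (mem_chart_source E q₀)⟩)
  · exact not_joinedByOrbitOfEnergy L A hA hA' q₀ hb hr
      (Metric.ball_subset_closedBall.trans hball)
      (fun x hx ↦ hL x (Metric.ball_subset_closedBall hx)) (by rw [hsq]; linarith) hq₁

end Construction

theorem lemma3p3p1 (S : Type*) [TopologicalSpace S]
    [ChartedSpace (EuclideanSpace ℝ (Fin 2)) S] [IsManifold (𝓡 2) ∞ S]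
    [T2Space S] [CompactSpace S] [ConnectedSpace S]
    (hS : IsOrientableManifold (EuclideanSpace ℝ (Fin 2)) S) (ε : ℝ) (hε : 0 < ε) :
    ∃ L : TangentBundle (𝓡 2) S → ℝ, IsMagneticLagrangian L ∧
      maneCriticalValueUniversal L ∈ Set.Icc ((1 / 2 - ε : ℝ) : EReal) ((1 / 2 : ℝ) : EReal) ∧
      ∃ q₀ q₁ : S, q₀ ≠ q₁ ∧ ∀ k : ℝ, k < 1 / 2 - ε → ¬ JoinedByOrbitOfEnergy L k q₀ q₁ := by
  have : Fact (Module.finrank ℝ (EuclideanSpace ℝ (Fin 2)) = 2) := ⟨by simp⟩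
  -- The orientation of the model plane serves to define the quarter turn A.
  let o : Orientation ℝ (EuclideanSpace ℝ (Fin 2)) (Fin 2) :=
    (EuclideanSpace.basisFun (Fin 2) ℝ).toBasis.orientation
  exact exists_magneticLagrangian_not_joined
    (o.rightAngleRotation : EuclideanSpace ℝ (Fin 2) →L[ℝ] EuclideanSpace ℝ (Fin 2))
    (fun x ↦ o.rightAngleRotation.norm_map x) o.inner_rightAngleRotation_swap'
    o.rightAngleRotation_rightAngleRotation hε
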